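/- Let $F$ be an arbitrary field and let $\mathbb{O}$ be an octonion algebra over $F$, i.e. an $8$-dimensional unital (not necessarily associative) $F$-algebra with a quadratic form $\mathrm{N}:\mathbb{O}\to F$ whose polar form $\langle x,y\rangle=\mathrm{N}(x+y)-\mathrm{N}(x)-\mathrm{N}(y)$ is non-degenerate and which satisfies $\mathrm{N}(xy)=\mathrm{N}(x)\mathrm{N}(y)$. Put $\mathrm{T}(x)=\langle x,1\rangle$ and $\bar{x}=\mathrm{T}(x)1-x$, so that $x\bar{x}=\mathrm{N}(x)1$, and call $\mathbb{O}$ split if $\mathrm{N}(x)=0$ for some $x\neq 0$. Octonions that are scalar multiples of $1$ are identified with scalars. Let $\mathbb{J}$ be the $27$-dimensional $F$-space of vectors $(a,b,c\mid A,B,C)$ with $a,b,c\in F$ and $A,B,C\in\mathbb{O}$, with the Dickson--Freudenthal determinant $$\Delta(a,b,c\mid A,B,C)=abc-aA\bar{A}-bB\bar{B}-cC\bar{C}+\mathrm{T}(ABC),$$ where products are read as $(AB)C$, and let $\mathrm{SE}_6(F)=\mathrm{SE}_6(F,\mathbb{O})$ be the group of all invertible $F$-linear maps $g:\mathbb{J}\to\mathbb{J}$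 with $\Delta(g(X))=\Delta(X)$ for all $X\in\mathbb{J}$. For $X=(a,b,c\mid A,B,C)$ and $Y=(d,e,f\mid D,E,G)$ put $$M(Y,X)=bcd+ace+abf-dA\bar{A}-eB\bar{B}-fC\bar{C}-a(D\bar{A}+A\bar{D})-b(E\bar{B}+B\bar{E})-c(G\bar{C}+C\bar{G})+\mathrm{T}(DBC+ECA+GAB).$$ A vector $X\neq 0$ in $\mathbb{J}$ is white if $M(Y,X)=0$ for all $Y\in\mathbb{J}$, and a white point is a $1$-dimensional subspace of $\mathbb{J}$ spanned by a white vector. Then there are at least two white points, $\mathrm{SE}_6(F)$ maps white points to white points, and its action on the set of white points is primitive (it is transitive, and the only invariant equivalence relations are equality and the universal relation). If $\mathbb{O}$ is not split, the action is even $2$-transitive (transitive on ordered pairs of distinct white points). -/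

import Mathlib

open scoped Pointwise

namespace AlbertE6

section

variable {F O : Type*} [Field F] [NonAssocRing O] [Module F O]

/-- `O` is an octonion algebra over `F` with norm `N`: an `8`-dimensional unital (not necessarily
associative) algebra with a multiplicative quadratic form whose polar form is non-degenerate. -/
structure IsOctonionNorm (N : QuadraticForm F O) : Prop where
  finrank_eq : Module.finrank F O = 8
  nondegenerate : N.polarBilin.Nondegenerate
  map_mul : ∀ x y : O, N (x * y) = N x * N y

/-- The octonion algebra with norm `N` is split: it has a non-zero isotropic element. -/
def IsSplit (N : QuadraticForm F O) : Prop :=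
  ∃ x : O, x ≠ 0 ∧ N x = 0

/-- The trace `T(x) = ⟨x, 1⟩`, where `⟨·, ·⟩` is the polar form of the norm. -/
def trace (N : QuadraticForm F O) (x : O) : F :=
  QuadraticMap.polar N x 1

/-- The conjugate `T(x) 1 - x`. -/
def conj (N : QuadraticForm F O) (x : O) : O :=
  trace N x • (1 : O) - x

variable (F O) in
/-- The Albert space. The element `((a, b, c), (A, B, C))` is the Albert vector `(a,b,c | A,B,C)`,
that is, the Hermitian matrix with rows `(a, C, conj B)`, `(conj C, b, A)`, `(B, conj A, c)`;
the diagonal entries are scalars. -/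
abbrev Albert := (F × F × F) × (O × O × O)

/-- The Dickson--Freudenthal determinant
`abc - a A(conj A) - b B(conj B) - c C(conj C) + T(ABC)`; the octonion `A(conj A) = N(A) 1` is read
as the scalar `N(A)`, see `mul_conj` below. -/
def det (N : QuadraticForm F O) : Albert F O → F
  | ((a, b, c), (A, B, C)) =>
    a * b * c - a * N A - b * N B - c * N C + trace N (A * B * C)

/-- The mixed form `M(Y, X)`, linear in `Y = (d,e,f | D,E,F')` and quadratic in
`X = (a,b,c | A,B,C)`; the octonion `D(conj A) + A(conj D) = ⟨D, A⟩ 1` is read as the scalar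
`⟨D, A⟩`, see `mul_conj_add_mul_conj` below. -/
def mixed (N : QuadraticForm F O) : Albert F O → Albert F O → F
  | ((d, e, f), (D, E, F')), ((a, b, c), (A, B, C)) =>
    b * c * d + a * c * e + a * b * f - d * N A - e * N B - f * N C
      - a * QuadraticMap.polar N D A - b * QuadraticMap.polar N E B
      - c * QuadraticMap.polar N F' C
      + trace N (D * B * C + E * C * A + F' * A * B)

/-- White vectors: non-zero Albert vectors `X` with `M(Y, X) = 0` for all `Y`. -/
def IsWhite (N : QuadraticForm F O) (X : Albert F O) : Prop :=
  X ≠ 0 ∧ ∀ Y : Albert F O, mixed N Y X = 0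

/-- White points: the `1`-dimensional subspaces spanned by white vectors. -/
def whitePoints (N : QuadraticForm F O) : Set (Submodule F (Albert F O)) :=
  {P | ∃ X : Albert F O, IsWhite N X ∧ P = Submodule.span F {X}}

/-- The group `SE₆(F, O)` of all invertible `F`-linear maps of the Albert space that preserve the
Dickson--Freudenthal determinant. -/
def SE6 (N : QuadraticForm F O) : Subgroup (Albert F O ≃ₗ[F] Albert F O) where
  carrier := {g | ∀ X, det N (g X) = det N X}
  mul_mem' {g h} hg hh X := by
    rw [LinearEquiv.mul_apply, hg, hh]
  one_mem' X := rfl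
  inv_mem' {g} hg X := by
    have h := hg (g⁻¹ X)
    rw [← LinearEquiv.mul_apply, mul_inv_cancel] at h
    exact h.symm

/-- `SE₆(F, O)` acts on subspaces by taking images. -/
theorem smul_eq_map (N : QuadraticForm F O) (g : SE6 N) (P : Submodule F (Albert F O)) :
    g • P = P.map (g : Albert F O ≃ₗ[F] Albert F O).toLinearMap := rfl

end

section

variable {F O : Type*} [Field F] [NonAssocRing O] [Module F O] [SMulCommClass F O O]

/-- `A (conj A) = N(A) 1`. -/
theorem mul_conj {N : QuadraticForm F O} (hN : IsOctonionNorm N) (x : O) :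
    x * conj N x = N x • (1 : O) := by
  have h1 : ∀ x y z : O, N.polarBilin (x * y) (x * z) = N x * N.polarBilin y z := by
    intro x y z
    simp only [QuadraticMap.polarBilin_apply_apply, QuadraticMap.polar]
    rw [← mul_add, hN.map_mul, hN.map_mul, hN.map_mul]
    ring
  have h2 : ∀ z : O, N.polarBilin (x * x) z + N.polarBilin x (x * z)
      = trace N x * N.polarBilin x z := by
    intro z
    have h := h1 (x + 1) x z
    rw [add_mul, add_mul, one_mul, one_mul, map_add, map_add, LinearMap.add_apply, LinearMap.add_apply,
      h1 x x z] at h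
    have h3 : N (x + 1) = N x + N 1 + trace N x := by
      simp only [trace, QuadraticMap.polar]
      ring
    have h4 := h1 1 x z
    rw [one_mul, one_mul] at h4
    rw [h3] at h
    linear_combination h - h4
  have h5 : ∀ z : O, N.polarBilin (x * conj N x - N x • (1 : O)) z = 0 := by
    intro z
    have h := h1 x 1 z
    rw [mul_one] at h
    rw [conj, mul_sub, mul_smul_comm, mul_one, map_sub, map_sub, map_smul, map_smul]
    simp only [LinearMap.sub_apply, LinearMap.smul_apply, smul_eq_mul]
    linear_combination h - h2 z
  exact sub_eq_zero.mp (hN.nondegenerate.1 _ h5)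

/-- `D (conj A) + A (conj D) = ⟨D, A⟩ 1`. -/
theorem mul_conj_add_mul_conj {N : QuadraticForm F O} (hN : IsOctonionNorm N) (x y : O) :
    x * conj N y + y * conj N x = QuadraticMap.polar N x y • (1 : O) := by
  have hc : conj N (x + y) = conj N x + conj N y := by
    simp only [conj, trace, QuadraticMap.polar_add_left, add_smul]
    abel
  have h := mul_conj hN (x + y)
  rw [hc, add_mul, mul_add, mul_add, mul_conj hN x, mul_conj hN y] at h
  rw [QuadraticMap.polar, sub_smul, sub_smul, ← h]
  abel

end

end AlbertE6

namespace AlbertE6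

set_option linter.unusedSectionVars false

/-! ### Trace, conjugation and norm of an octonion algebra -/

section Octonion

variable {F O : Type*} [Field F] [NonAssocRing O] [Module F O]
variable {N : QuadraticForm F O}

open QuadraticMap (polar)

/-! White vectors are the zeros of the gradient of Δ, the "rank one" matrices. Write e₁, e₂ for the
first two diagonal unit vectors. The cyclic rotation, the interchange of coordinates and the
transvections preserve both Δ and M (`mixedIsometries`), and Gaussian elimination with them moves
every white point to ⟨e₁⟩ (`IsWhite.exists_map_eq`); this gives transitivity.

Relative to ⟨e₁⟩ a white point (a,b,c|A,B,C) is opposite if (b,c,A) ≠ 0, and otherwise it is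
(a,0,0|0,B,C). Maps that fix e₁ move every opposite point to ⟨e₂⟩
(`IsWhite.exists_map_eq_of_opposite`), and every other point except ⟨e₁⟩ to some ⟨(0,0,0|0,0,C)⟩
with N(C) = 0 (`IsWhite.exists_map_eq_of_not_opposite`). If the octonions are not split, the latter
kind does not exist, whence 2-transitivity. In general a block that contains ⟨e₁⟩ and a second point
contains an opposite one, because a suitable transvection fixes ⟨(0,0,0|0,0,C)⟩ and makes e₁
opposite. It then contains all points opposite to ⟨e₁⟩ and, by rotation, everything
(`forall_isWhite_of_block`).

Over small fields Δ as a function need not determine M, so that SE₆ preserves whiteness requires an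
argument. The complete polarization of Δ is preserved over any field, and fixing e₁ as one argument
leaves a bilinear form with a radical of dimension at least 17; among vectors in normal form only
multiples of e₁ allow this (`eq_zero_of_map_eq_normal_form`). -/

theorem trace_add (x y : O) : trace N (x + y) = trace N x + trace N y :=
  QuadraticMap.polar_add_left N x y 1

theorem trace_zero : trace N (0 : O) = 0 := QuadraticMap.polar_zero_left N 1

theorem trace_smul (a : F) (x : O) : trace N (a • x) = a * trace N x := by
  rw [trace, QuadraticMap.polar_smul_left, smul_eq_mul, trace]

variable (N) in
/-- Conjugation as a linear map. -/
def conjLinear : O →ₗ[F] O where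
  toFun := conj N
  map_add' x y := by
    simp only [conj, trace_add, add_smul]
    abel
  map_smul' a x := by
    simp only [conj, trace_smul, mul_smul, smul_sub, RingHom.id_apply]

theorem conj_add (x y : O) : conj N (x + y) = conj N x + conj N y := (conjLinear N).map_add x y

theorem conj_smul (a : F) (x : O) : conj N (a • x) = a • conj N x := (conjLinear N).map_smul a x

theorem conj_zero : conj N (0 : O) = 0 := (conjLinear N).map_zero

theorem conj_neg (x : O) : conj N (-x) = -conj N x := (conjLinear N).map_neg x

theorem map_add_polar (x y : O) : N (x + y) = N x + N y + polar N x y := by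
  rw [QuadraticMap.polar]
  ring

theorem polar_self' (x : O) : polar N x x = 2 * N x := by
  rw [QuadraticMap.polar_self, nsmul_eq_mul, Nat.cast_ofNat]

namespace IsOctonionNorm

variable (hN : IsOctonionNorm N)

include hN

theorem eq_zero_of_polar {x : O} (h : ∀ y, polar N x y = 0) : x = 0 :=
  hN.nondegenerate.1 x h

theorem ext_polar {x y : O} (h : ∀ z, polar N x z = polar N y z) : x = y := by
  rw [← sub_eq_zero]
  exact hN.eq_zero_of_polar fun z => by rw [QuadraticMap.polar_sub_left, h, sub_self]

theorem exists_polar_ne_zero {x : O} (h : x ≠ 0) : ∃ y, polar N y x ≠ 0 := by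
  by_contra! h'
  exact h (hN.eq_zero_of_polar fun y => by rw [QuadraticMap.polar_comm, h'])

theorem finite : Module.Finite F O :=
  Module.finite_of_finrank_pos (by rw [hN.finrank_eq]; norm_num)

theorem nontrivial : Nontrivial O :=
  Module.nontrivial_of_finrank_pos (R := F) (by rw [hN.finrank_eq]; norm_num)

theorem map_one : N 1 = 1 := by
  have h := hN.map_mul 1 1
  rw [one_mul] at h
  by_contra h1
  have h0 : N 1 = 0 := by
    by_contra h2
    exact h1 (mul_left_cancel₀ h2 (by rw [← h, mul_one]))
  -- Multiplicativity leaves only N(1) = 0 or 1, and N(1) = 0 would make N vanish identically.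
  have hz : ∀ x, N x = 0 := fun x => by rw [← one_mul x, hN.map_mul, h0, zero_mul]
  have := hN.nontrivial
  exact one_ne_zero (hN.eq_zero_of_polar (x := 1) fun y => by simp [QuadraticMap.polar, hz])

theorem polar_mul_left (x y z : O) : polar N (x * y) (x * z) = N x * polar N y z := by
  simp only [QuadraticMap.polar, ← mul_add, hN.map_mul]
  ring

theorem polar_mul_right (x y z : O) : polar N (y * x) (z * x) = polar N y z * N x := by
  simp only [QuadraticMap.polar, ← add_mul, hN.map_mul]
  ring

theorem trace_one : trace N (1 : O) = 2 := by
  rw [trace, polar_self', hN.map_one, mul_one]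

theorem conj_conj (x : O) : conj N (conj N x) = x := by
  have : conj N (1 : O) = 1 := by
    rw [conj, hN.trace_one, two_smul, add_sub_cancel_right]
  rw [conj.eq_1 N x, sub_eq_add_neg, conj_add, conj_neg, conj_smul, this, conj]
  abel

theorem polar_conj (x y : O) : polar N (conj N x) (conj N y) = polar N x y := by
  simp only [conj, sub_eq_add_neg, QuadraticMap.polar_add_left, QuadraticMap.polar_add_right,
    QuadraticMap.polar_neg_left, QuadraticMap.polar_neg_right, QuadraticMap.polar_smul_left,
    QuadraticMap.polar_smul_right, smul_eq_mul]
  rw [QuadraticMap.polar_comm N 1 y]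
  have := hN.trace_one
  simp only [trace] at *
  rw [this]
  ring

theorem map_conj (x : O) : N (conj N x) = N x := by
  rw [conj, sub_eq_add_neg, map_add_polar, QuadraticMap.polar_neg_right,
    QuadraticMap.polar_smul_left, QuadraticMap.map_smul, QuadraticMap.map_neg, hN.map_one,
    QuadraticMap.polar_comm]
  simp only [smul_eq_mul, trace]
  ring

theorem trace_conj (x : O) : trace N (conj N x) = trace N x := by
  have h : conj N (1 : O) = 1 := by
    rw [conj, hN.trace_one, two_smul, add_sub_cancel_right]
  rw [trace, ← h, hN.polar_conj, trace]

end IsOctonionNorm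

end Octonion

/-! ### Adjoints of multiplications and associativity of the trace -/

section Octonion

variable {F O : Type*} [Field F] [NonAssocRing O] [Module F O]
variable {N : QuadraticForm F O}

open QuadraticMap (polar)

namespace IsOctonionNorm

variable [SMulCommClass F O O] [IsScalarTower F O O] (hN : IsOctonionNorm N)

include hN

/-- Comes from ⟨xy, xz⟩ = N(x)⟨y, z⟩ by replacing x with x + 1 and comparing the mixed terms. -/
theorem polar_mul_conj (x y z : O) : polar N (x * y) z = polar N y (conj N x * z) := by
  have h := hN.polar_mul_left (x + 1) y z
  have e : N (x + 1) = N x + N 1 + trace N x := map_add_polar x 1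
  simp only [add_mul, one_mul, QuadraticMap.polar_add_left, QuadraticMap.polar_add_right,
    hN.polar_mul_left, e, hN.map_one] at h
  rw [conj, sub_mul, smul_mul_assoc, one_mul, QuadraticMap.polar_sub_right,
    QuadraticMap.polar_smul_right, smul_eq_mul]
  linear_combination h

theorem polar_mul_conj' (x y z : O) : polar N (x * y) z = polar N x (z * conj N y) := by
  have h := hN.polar_mul_right (y + 1) x z
  have e : N (y + 1) = N y + N 1 + trace N y := map_add_polar y 1
  simp only [mul_add, mul_one, QuadraticMap.polar_add_left, QuadraticMap.polar_add_right,
    hN.polar_mul_right, e, hN.map_one] at h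
  rw [conj, mul_sub, mul_smul_comm, mul_one, QuadraticMap.polar_sub_right,
    QuadraticMap.polar_smul_right, smul_eq_mul]
  linear_combination h

theorem trace_mul (x y : O) : trace N (x * y) = polar N x (conj N y) := by
  rw [trace, hN.polar_mul_conj', one_mul]

theorem trace_mul_comm (x y : O) : trace N (x * y) = trace N (y * x) := by
  rw [hN.trace_mul, ← hN.polar_conj, hN.conj_conj, QuadraticMap.polar_comm, hN.trace_mul]

theorem conj_mul (x y : O) : conj N (x * y) = conj N y * conj N x := by
  refine hN.ext_polar fun z => ?_
  have h := hN.polar_mul_conj z x (conj N y)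
  have h' := hN.polar_mul_conj' z x (conj N y)
  rw [← hN.polar_conj, hN.conj_conj, hN.polar_mul_conj', ← h, h', QuadraticMap.polar_comm]

theorem trace_assoc (x y z : O) : trace N (x * y * z) = trace N (x * (y * z)) := by
  rw [hN.trace_mul, hN.polar_mul_conj', hN.trace_mul, hN.conj_mul]

theorem trace_rotate (x y z : O) : trace N (x * y * z) = trace N (y * z * x) := by
  rw [hN.trace_assoc, hN.trace_mul_comm]

theorem conj_mul_cancel (x y : O) : conj N x * (x * y) = N x • y := by
  refine hN.ext_polar fun z => ?_
  rw [hN.polar_mul_conj, hN.conj_conj, hN.polar_mul_left, QuadraticMap.polar_smul_left,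
    smul_eq_mul]

theorem mul_mul_conj_cancel (x y : O) : y * x * conj N x = N x • y := by
  refine hN.ext_polar fun z => ?_
  rw [hN.polar_mul_conj', hN.conj_conj, hN.polar_mul_right, QuadraticMap.polar_smul_left,
    smul_eq_mul, mul_comm]

/-- Linearization in w of w(w̄u) = N(w)u. It serves to show that w̄u = 0 with w ≠ 0 puts u into w𝕆.
-/
theorem mul_conj_mul_add (x z u : O) :
    x * (conj N z * u) + z * (conj N x * u) = polar N x z • u := by
  have h (w : O) : w * (conj N w * u) = N w • u := by
    have := hN.conj_mul_cancel (conj N w) u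
    rwa [hN.conj_conj, hN.map_conj] at this
  have hxz := h (x + z)
  rw [conj_add, add_mul, add_mul, mul_add, mul_add, h, h, map_add_polar, add_smul, add_smul] at hxz
  have e := sub_eq_zero.2 hxz
  rw [← sub_eq_zero, ← e]
  abel

theorem polar_conj_mul (x y z : O) : polar N x (conj N (y * z)) = trace N (x * y * z) := by
  rw [hN.trace_assoc, hN.trace_mul]

/-- The cancellation behind the invariance of Δ under transvections: it matches the new part of
T(ABC) with that of bN(B). Its linearization in y, below, does the same for M. -/
theorem trace_conj_mul_mul (x y z : O) :
    trace N (conj N (y * x) * y * z) = N y * polar N x z := by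
  have h : conj N x * conj N y * y = N y • conj N x := by
    have := hN.mul_mul_conj_cancel (conj N y) (conj N x)
    rwa [hN.conj_conj, hN.map_conj] at this
  rw [hN.conj_mul, h, smul_mul_assoc, trace_smul, hN.trace_mul, hN.polar_conj]

theorem trace_conj_mul_mul_add (x y w z : O) :
    trace N (conj N (w * x) * y * z) + trace N (conj N (y * x) * w * z)
      = polar N w y * polar N x z := by
  have h := hN.trace_conj_mul_mul x (w + y) z
  simp only [add_mul, mul_add, conj_add, trace_add, hN.trace_conj_mul_mul, map_add_polar] at h
  linear_combination h

theorem trace_conj_mul_conj_mul (x y z : O) :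
    trace N (conj N y * conj N x * conj N z) = trace N (x * y * z) := by
  rw [← hN.conj_mul, ← hN.conj_mul, hN.trace_conj, hN.trace_mul_comm]

/-- The orthogonal complement of a vector is not totally singular. -/
theorem exists_polar_eq_zero_and_ne_zero (A : O) : ∃ x, polar N x A = 0 ∧ N x ≠ 0 := by
  by_contra! h
  have := hN.finite
  have h2 (u v : O) (hu : polar N u A = 0) (hv : polar N v A = 0) : polar N u v = 0 := by
    rw [QuadraticMap.polar, h u hu, h v hv, h (u + v) (by
      rw [QuadraticMap.polar_add_left, hu, hv, add_zero])]
    ring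
  let f : O →ₗ[F] F := N.polarBilin A
  have hk (u : O) : u ∈ LinearMap.ker f ↔ polar N u A = 0 := by
    rw [QuadraticMap.polar_comm]; rfl
  have hle : LinearMap.ker f ≤ Submodule.span F {A} := by
    intro u hu
    have hku : LinearMap.ker f ≤ LinearMap.ker (N.polarBilin u) := fun v hv =>
      h2 u v ((hk u).1 hu) ((hk v).1 hv)
    -- If N vanishes on the hyperplane A^⊥, so does its polar form. For u in A^⊥ the functional ⟨u,
    -- ·⟩ is then a multiple of ⟨A, ·⟩, so A^⊥ has dimension at most 1 instead of at least 7.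
    have hs := mem_span_of_iInf_ker_le_ker (L := fun _ : Unit => f) (by simpa using hku)
    rw [Set.range_const, Submodule.mem_span_singleton] at hs
    obtain ⟨c, hc⟩ := hs
    rw [Submodule.mem_span_singleton]
    refine ⟨c, hN.ext_polar fun z => ?_⟩
    rw [QuadraticMap.polar_smul_left]
    exact LinearMap.congr_fun hc z
  have h1 := Submodule.finrank_mono hle
  have h3 := f.finrank_range_add_finrank_ker
  have h4 : Module.finrank F (LinearMap.range f) ≤ 1 := by
    simpa using (LinearMap.range f).finrank_le
  have h5 := (finrank_span_le_card (R := F) {A}).trans_eq (Set.toFinset_card _)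
  rw [hN.finrank_eq] at h3
  rw [Fintype.card_unique] at h5
  omega

end IsOctonionNorm

end Octonion

/-! ### Elementary isometries of Δ and M -/

section Generators

variable {F O : Type*} [Field F] [NonAssocRing O] [Module F O]
variable {N : QuadraticForm F O}

open QuadraticMap (polar)

variable (N) in
/-- The invertible linear maps preserving the determinant and the mixed form. These are the
isometries of the determinant as a polynomial function; over small fields this is a priori smaller
than `SE6 N`. -/
def mixedIsometries : Subgroup (Albert F O ≃ₗ[F] Albert F O) where
  carrier := {g | (∀ X, det N (g X) = det N X) ∧ ∀ Y X, mixed N (g Y) (g X) = mixed N Y X}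
  mul_mem' {g h} hg hh := by
    refine ⟨fun X => ?_, fun Y X => ?_⟩
    · rw [LinearEquiv.mul_apply, hg.1, hh.1]
    · rw [LinearEquiv.mul_apply, LinearEquiv.mul_apply, hg.2, hh.2]
  one_mem' := ⟨fun _ => rfl, fun _ _ => rfl⟩
  inv_mem' {g} hg := by
    have h (X : Albert F O) : g (g⁻¹ X) = X := by rw [← LinearEquiv.mul_apply, mul_inv_cancel]; rfl
    refine ⟨fun X => ?_, fun Y X => ?_⟩
    · rw [← hg.1, h]
    · rw [← hg.2, h, h]

theorem mixedIsometries_le : mixedIsometries N ≤ SE6 N := fun _ hg => hg.1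

theorem IsWhite.map {X : Albert F O} (hX : IsWhite N X) {g : Albert F O ≃ₗ[F] Albert F O}
    (hg : g ∈ mixedIsometries N) : IsWhite N (g X) := by
  refine ⟨fun h => hX.1 (g.map_eq_zero_iff.1 h), fun Y => ?_⟩
  rw [← g.apply_symm_apply Y, hg.2, hX.2]

variable (F O) in
/-- The cyclic permutation of the three coordinates. -/
def rotation : Albert F O ≃ₗ[F] Albert F O where
  toFun X := ((X.1.2.1, X.1.2.2, X.1.1), (X.2.2.1, X.2.2.2, X.2.1))
  invFun X := ((X.1.2.2, X.1.1, X.1.2.1), (X.2.2.2, X.2.1, X.2.2.1))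
  map_add' _ _ := rfl
  map_smul' _ _ := rfl
  left_inv _ := rfl
  right_inv _ := rfl

theorem rotation_apply (a b c : F) (A B C : O) :
    rotation F O ((a, b, c), (A, B, C)) = ((b, c, a), (B, C, A)) := rfl

/-- The interchange of the first two coordinates. -/
def swap (hN : IsOctonionNorm N) : Albert F O ≃ₗ[F] Albert F O where
  toFun X := ((X.1.2.1, X.1.1, X.1.2.2), (conj N X.2.2.1, conj N X.2.1, conj N X.2.2.2))
  invFun X := ((X.1.2.1, X.1.1, X.1.2.2), (conj N X.2.2.1, conj N X.2.1, conj N X.2.2.2))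
  map_add' X Y := by simp [conj_add]
  map_smul' a X := by simp [conj_smul]
  left_inv X := by simp [hN.conj_conj]
  right_inv X := by simp [hN.conj_conj]

theorem swap_apply (hN : IsOctonionNorm N) (a b c : F) (A B C : O) :
    swap hN ((a, b, c), (A, B, C)) = ((b, a, c), (conj N B, conj N A, conj N C)) := rfl

variable [SMulCommClass F O O] [IsScalarTower F O O]

variable (N) in
/-- The transvection `X ↦ Mᴴ X M`, where `M` is the identity matrix with an additional entry `x`
in position `(1, 2)`. -/
def transvection (x : O) : Albert F O ≃ₗ[F] Albert F O where
  toFun X := ((X.1.1, X.1.2.1 + X.1.1 * N x + polar N x X.2.2.2, X.1.2.2),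
    (X.2.1 + conj N (X.2.2.1 * x), X.2.2.1, X.2.2.2 + X.1.1 • x))
  invFun X := ((X.1.1, X.1.2.1 + X.1.1 * N x - polar N x X.2.2.2, X.1.2.2),
    (X.2.1 - conj N (X.2.2.1 * x), X.2.2.1, X.2.2.2 - X.1.1 • x))
  map_add' X Y := by
    ext <;> simp [conj_add, add_mul, add_smul, QuadraticMap.polar_add_right] <;> first | ring | abel
  map_smul' a X := by
    ext <;> simp [← conj_smul, mul_smul, QuadraticMap.polar_smul_right, smul_mul_assoc]
    ring
  left_inv X := by
    ext <;> simp [QuadraticMap.polar_add_right, QuadraticMap.polar_smul_right]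
    ring
  right_inv X := by
    ext <;> simp [QuadraticMap.polar_sub_right, QuadraticMap.polar_smul_right]
    ring

theorem transvection_apply (x : O) (a b c : F) (A B C : O) :
    transvection N x ((a, b, c), (A, B, C)) =
      ((a, b + a * N x + polar N x C, c), (A + conj N (B * x), B, C + a • x)) := rfl

theorem rotation_mem (hN : IsOctonionNorm N) : rotation F O ∈ mixedIsometries N := by
  refine ⟨?_, ?_⟩
  · rintro ⟨⟨a, b, c⟩, A, B, C⟩
    rw [rotation_apply, det, det, ← hN.trace_rotate]
    ring
  · rintro ⟨⟨d, e, f⟩, D, E, G⟩ ⟨⟨a, b, c⟩, A, B, C⟩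
    simp only [rotation_apply, mixed, trace_add]
    ring

theorem swap_mem (hN : IsOctonionNorm N) : swap hN ∈ mixedIsometries N := by
  refine ⟨?_, ?_⟩
  · rintro ⟨⟨a, b, c⟩, A, B, C⟩
    simp only [swap_apply, det, hN.map_conj, hN.trace_conj_mul_conj_mul]
    ring
  · rintro ⟨⟨d, e, f⟩, D, E, G⟩ ⟨⟨a, b, c⟩, A, B, C⟩
    simp only [swap_apply, mixed, trace_add, hN.map_conj, hN.trace_conj_mul_conj_mul,
      hN.polar_conj]
    rw [hN.trace_rotate A E C, hN.trace_rotate C D B, hN.trace_rotate B G A]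
    ring

theorem transvection_mem (hN : IsOctonionNorm N) (x : O) :
    transvection N x ∈ mixedIsometries N := by
  have hr (U V : O) (z : O) : trace N (U * z * conj N (V * x)) = trace N (conj N (V * x) * U * z) :=
    (hN.trace_rotate _ _ _).symm
  have hr' (U V : O) (z : O) : trace N (z * conj N (V * x) * U) = trace N (conj N (V * x) * U * z) :=
    hN.trace_rotate _ _ _
  refine ⟨?_, ?_⟩
  · rintro ⟨⟨a, b, c⟩, A, B, C⟩
    simp only [transvection_apply, det, map_add_polar, hN.map_conj, hN.map_mul,
      hN.polar_conj_mul, QuadraticMap.map_smul, add_mul, mul_add, trace_add, mul_smul_comm,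
      trace_smul, hN.trace_conj_mul_mul, QuadraticMap.polar_smul_right, polar_self', smul_eq_mul]
    rw [QuadraticMap.polar_comm N C x]
    ring
  · rintro ⟨⟨d, e, f⟩, D, E, G⟩ ⟨⟨a, b, c⟩, A, B, C⟩
    have h1 := hN.trace_conj_mul_mul_add x B E C
    have h2 (U V : O) : trace N (conj N (U * x) * V * x) = polar N U V * N x := by
      rw [← hN.polar_conj_mul, hN.polar_conj, hN.polar_mul_right]
    have h3 := hN.trace_conj_mul_mul x B G
    have h4 : polar N (conj N (E * x)) A = trace N (A * E * x) := by
      rw [QuadraticMap.polar_comm, hN.polar_conj_mul]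
    simp only [transvection_apply, mixed, map_add_polar, hN.map_conj, hN.map_mul,
      hN.polar_conj_mul, h4, h2,
      QuadraticMap.map_smul, add_mul, mul_add, trace_add, mul_smul_comm, smul_mul_assoc,
      QuadraticMap.polar_add_left, QuadraticMap.polar_add_right, QuadraticMap.polar_smul_left,
      trace_smul, hr, hr', QuadraticMap.polar_smul_right, polar_self', smul_eq_mul]
    rw [QuadraticMap.polar_comm N G x, QuadraticMap.polar_comm N C x,
      QuadraticMap.polar_comm N B E, hN.trace_rotate x A B, ← hN.trace_rotate A E x]
    linear_combination h1 + h3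

end Generators

/-! ### Orbits on white vectors, by Gaussian elimination -/

section Orbits

variable {F O : Type*} [Field F] [NonAssocRing O] [Module F O]
variable {N : QuadraticForm F O} [SMulCommClass F O O] [IsScalarTower F O O]

open QuadraticMap (polar)

/-- The coordinates of the gradient of Δ, read off by testing M against each coordinate subspace. -/
theorem IsWhite.equations (hN : IsOctonionNorm N) {a b c : F} {A B C : O}
    (h : IsWhite N ((a, b, c), (A, B, C))) :
    (b * c = N A ∧ a * c = N B ∧ a * b = N C) ∧
      a • A = conj N (B * C) ∧ b • B = conj N (C * A) ∧ c • C = conj N (A * B) := by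
  have h := h.2
  refine ⟨⟨?_, ?_, ?_⟩, ?_, ?_, ?_⟩
  · simpa [mixed, trace, sub_eq_zero] using h ((1, 0, 0), (0, 0, 0))
  · simpa [mixed, trace, sub_eq_zero] using h ((0, 1, 0), (0, 0, 0))
  · simpa [mixed, trace, sub_eq_zero] using h ((0, 0, 1), (0, 0, 0))
  · refine hN.ext_polar fun z => ?_
    rw [QuadraticMap.polar_comm, QuadraticMap.polar_smul_right, QuadraticMap.polar_comm N _ z,
      hN.polar_conj_mul]
    simpa [mixed, neg_add_eq_zero] using h ((0, 0, 0), (z, 0, 0))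
  · refine hN.ext_polar fun z => ?_
    rw [QuadraticMap.polar_comm, QuadraticMap.polar_smul_right, QuadraticMap.polar_comm N _ z,
      hN.polar_conj_mul]
    simpa [mixed, neg_add_eq_zero] using h ((0, 0, 0), (0, z, 0))
  · refine hN.ext_polar fun z => ?_
    rw [QuadraticMap.polar_comm, QuadraticMap.polar_smul_right, QuadraticMap.polar_comm N _ z,
      hN.polar_conj_mul]
    simpa [mixed, neg_add_eq_zero] using h ((0, 0, 0), (0, 0, z))

theorem isWhite_diagonal {a : F} (ha : a ≠ 0) :
    IsWhite N ((a, 0, 0), (0, 0, 0)) := by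
  refine ⟨fun h => ha (congrArg (·.1.1) h), ?_⟩
  rintro ⟨⟨d, e, f⟩, D, E, G⟩
  simp [mixed, trace]

theorem exists_mixedIsometries_swap₂₃ (hN : IsOctonionNorm N) :
    ∃ g ∈ mixedIsometries N, ∀ (a b c : F) (A B C : O), g ((a, b, c), (A, B, C)) =
      ((a, c, b), (conj N A, conj N C, conj N B)) :=
  ⟨(rotation F O)⁻¹ * swap hN * rotation F O,
    mul_mem (mul_mem (inv_mem (rotation_mem hN)) (swap_mem hN)) (rotation_mem hN),
    fun _ _ _ _ _ _ => rfl⟩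

theorem exists_mixedIsometries_transvection₂₃ (hN : IsOctonionNorm N) (x : O) :
    ∃ g ∈ mixedIsometries N, ∀ (a b c : F) (A B C : O), g ((a, b, c), (A, B, C)) =
      ((a, b, c + b * N x + polar N x A), (A + b • x, B + conj N (C * x), C)) :=
  ⟨(rotation F O)⁻¹ * transvection N x * rotation F O,
    mul_mem (mul_mem (inv_mem (rotation_mem hN)) (transvection_mem hN x)) (rotation_mem hN),
    fun _ _ _ _ _ _ => rfl⟩

theorem exists_mixedIsometries_transvection₂₁ (hN : IsOctonionNorm N) (x : O) :
    ∃ g ∈ mixedIsometries N, ∀ (a b c : F) (A B C : O), g ((a, b, c), (A, B, C)) =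
      ((a + b * N x + polar N x (conj N C), b, c),
        (A, B + conj N A * x, C + b • conj N x)) :=
  ⟨swap hN * transvection N x * swap hN,
    mul_mem (mul_mem (swap_mem hN) (transvection_mem hN x)) (swap_mem hN),
    fun a b c A B C => by
      simp only [LinearEquiv.mul_apply, swap_apply, transvection_apply, conj_add, conj_smul,
        hN.conj_conj]⟩

theorem exists_mixedIsometries_transvection₁₃ (hN : IsOctonionNorm N) (x : O) :
    ∃ g ∈ mixedIsometries N, ∀ (a b c : F) (A B C : O), g ((a, b, c), (A, B, C)) =
      ((a, b, c + a * N x + polar N x (conj N B)),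
        (A + conj N C * x, B + a • conj N x, C)) := by
  obtain ⟨s, hs, hs'⟩ := exists_mixedIsometries_swap₂₃ hN
  refine ⟨s * transvection N x * s, mul_mem (mul_mem hs (transvection_mem hN x)) hs,
    fun a b c A B C => ?_⟩
  simp only [LinearEquiv.mul_apply, hs', transvection_apply, conj_add, conj_smul, hN.conj_conj]

/-- A non-zero diagonal entry can be moved to the first place. -/
theorem exists_rotate_fst_ne_zero (hN : IsOctonionNorm N) (X : Albert F O) (h : X.1 ≠ 0) :
    ∃ g ∈ mixedIsometries N, (g X).1.1 ≠ 0 := by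
  have hr := rotation_mem (N := N) hN
  by_contra! h'
  refine h (Prod.ext ?_ (Prod.ext ?_ ?_))
  · exact h' 1 (one_mem _)
  · exact h' _ hr
  · exact h' _ (mul_mem hr hr)

theorem exists_fst_ne_zero (hN : IsOctonionNorm N) {X : Albert F O} (h : X ≠ 0) :
    ∃ g ∈ mixedIsometries N, (g X).1.1 ≠ 0 := by
  have hr := rotation_mem (N := N) hN
  suffices h1 : ∃ g ∈ mixedIsometries N, (g X).1 ≠ 0 by
    obtain ⟨g, hg, hX⟩ := h1
    obtain ⟨k, hk, hX⟩ := exists_rotate_fst_ne_zero hN _ hX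
    exact ⟨k * g, mul_mem hk hg, hX⟩
  by_contra! h'
  -- If the diagonal vanishes throughout the orbit, so does C, as a transvection by x would put ⟨x,
  -- C⟩ on the diagonal.
  have key (Y : Albert F O) (hY : ∃ g ∈ mixedIsometries N, g X = Y) : Y.2.2.2 = 0 := by
    obtain ⟨g, hg, rfl⟩ := hY
    by_contra hC
    obtain ⟨x, hx⟩ := hN.exists_polar_ne_zero hC
    have h2 : (g X).1.2.1 + (g X).1.1 * N x + polar N x (g X).2.2.2 = 0 :=
      congrArg (·.2.1) (h' _ (mul_mem (transvection_mem hN x) hg))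
    rw [h' g hg] at h2
    exact hx (by simpa using h2)
  refine h (Prod.ext (h' 1 (one_mem _)) (Prod.ext ?_ (Prod.ext ?_ ?_)))
  · exact key _ ⟨_, hr, rfl⟩
  · exact key _ ⟨_, mul_mem hr hr, rfl⟩
  · exact key _ ⟨1, one_mem _, rfl⟩

/-- Every non-zero Albert vector can be brought to the form `(a, b, c | A, 0, 0)` with `a ≠ 0`. -/
theorem exists_normal_form (hN : IsOctonionNorm N) {X : Albert F O} (h : X ≠ 0) :
    ∃ g ∈ mixedIsometries N, ∃ (a b c : F) (A : O), a ≠ 0 ∧ g X = ((a, b, c), (A, 0, 0)) := by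
  obtain ⟨g, hg, ha⟩ := exists_fst_ne_zero hN h
  obtain ⟨⟨⟨a, b, c⟩, A, B, C⟩, hX⟩ : ∃ Y, g X = Y := ⟨_, rfl⟩
  rw [hX] at ha
  change a ≠ 0 at ha
  obtain ⟨t, ht, ht'⟩ := exists_mixedIsometries_transvection₁₃ hN (-a⁻¹ • conj N B)
  refine ⟨t * (transvection N (-a⁻¹ • C) * g), mul_mem ht (mul_mem (transvection_mem hN _) hg),
    ?_⟩
  rw [LinearEquiv.mul_apply, LinearEquiv.mul_apply, hX, transvection_apply, ht']
  refine ⟨a, _, _, _, ha, Prod.ext rfl (Prod.ext rfl (Prod.ext ?_ ?_))⟩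
  · simp [conj_neg, conj_smul, hN.conj_conj, smul_smul, ha]
  · simp [smul_smul, ha]

theorem IsWhite.eq_zero_of_normal_form (hN : IsOctonionNorm N) {a b c : F} {A : O} (ha : a ≠ 0)
    (h : IsWhite N ((a, b, c), (A, 0, 0))) : b = 0 ∧ c = 0 ∧ A = 0 := by
  obtain ⟨⟨-, h1, h2⟩, h3, -⟩ := h.equations hN
  simpa [ha, conj_zero, and_left_comm, and_comm] using And.intro h1 (And.intro h2 h3)

theorem IsWhite.exists_map_eq (hN : IsOctonionNorm N) {X : Albert F O} (h : IsWhite N X) :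
    ∃ g ∈ mixedIsometries N, ∃ a : F, a ≠ 0 ∧ g X = ((a, 0, 0), (0, 0, 0)) := by
  obtain ⟨g, hg, a, b, c, A, ha, hX⟩ := exists_normal_form hN h.1
  have hw := h.map hg
  rw [hX] at hw
  obtain ⟨rfl, rfl, rfl⟩ := hw.eq_zero_of_normal_form hN ha
  exact ⟨g, hg, a, ha, hX⟩

theorem exists_map_eq_self_and_snd_ne_zero (hN : IsOctonionNorm N) {X : Albert F O}
    (h0 : ¬ (X.1.2 = 0 ∧ X.2.1 = 0)) :
    ∃ g ∈ mixedIsometries N, g ((1, 0, 0), (0, 0, 0)) = ((1, 0, 0), (0, 0, 0)) ∧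
      (g X).1.2.1 ≠ 0 := by
  obtain ⟨⟨a, b, c⟩, A, B, C⟩ := X
  obtain ⟨s, hs, hs'⟩ := exists_mixedIsometries_swap₂₃ hN
  have hs1 : s ((1, 0, 0), (0, 0, 0)) = ((1, 0, 0), (0, 0, 0)) := by simp [hs', conj_zero]
  by_contra! h
  have hb : b = 0 := h 1 (one_mem _) rfl
  have hc : c = 0 := by simpa [hs'] using h s hs hs1
  have hA : A ≠ 0 := fun hA => h0 ⟨Prod.ext hb hc, hA⟩
  obtain ⟨x, hx⟩ := hN.exists_polar_ne_zero hA
  obtain ⟨t, ht, ht'⟩ := exists_mixedIsometries_transvection₂₃ hN x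
  have := h (s * t) (mul_mem hs ht) (by simp [LinearEquiv.mul_apply, ht', hs', conj_zero])
  simp [LinearEquiv.mul_apply, ht', hs', hb, hc, hx] at this

/-- The stabilizer of the first coordinate vector acts transitively on the white points that are
opposite to it. -/
theorem IsWhite.exists_map_eq_of_opposite (hN : IsOctonionNorm N) {X : Albert F O}
    (h : IsWhite N X) (h0 : ¬ (X.1.2 = 0 ∧ X.2.1 = 0)) :
    ∃ g ∈ mixedIsometries N, g ((1, 0, 0), (0, 0, 0)) = ((1, 0, 0), (0, 0, 0)) ∧
      ∃ b : F, b ≠ 0 ∧ g X = ((0, b, 0), (0, 0, 0)) := by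
  obtain ⟨g, hg, hg1, hb⟩ := exists_map_eq_self_and_snd_ne_zero hN h0
  obtain ⟨⟨⟨a, b, c⟩, A, B, C⟩, hX⟩ : ∃ Y, g X = Y := ⟨_, rfl⟩
  rw [hX] at hb
  change b ≠ 0 at hb
  obtain ⟨t, ht, ht'⟩ := exists_mixedIsometries_transvection₂₃ hN (-b⁻¹ • A)
  obtain ⟨u, hu, hu'⟩ := exists_mixedIsometries_transvection₂₁ hN (-b⁻¹ • conj N C)
  have hmem : u * (t * g) ∈ mixedIsometries N := mul_mem hu (mul_mem ht hg)
  refine ⟨u * (t * g), hmem, ?_, b, hb, ?_⟩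
  · simp [LinearEquiv.mul_apply, hg1, ht', hu', conj_zero]
  -- Once A and C are cleared, the white equations with b ≠ 0 force the remaining entries a, c and B
  -- to vanish.
  · have hw := h.map hmem
    obtain ⟨a', c', B', hY⟩ :
        ∃ (a' c' : F) (B' : O), (u * (t * g)) X = ((a', b, c'), (0, B', 0)) := by
      rw [LinearEquiv.mul_apply, LinearEquiv.mul_apply, hX, ht', hu']
      refine ⟨_, _, _, Prod.ext rfl (Prod.ext ?_ (Prod.ext rfl ?_))⟩
      · simp [smul_smul, hb]
      · simp [conj_neg, conj_smul, hN.conj_conj, smul_smul, hb]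
    rw [hY] at hw ⊢
    obtain ⟨⟨h1, -, h2⟩, -, h3, -⟩ := hw.equations hN
    simp_all [conj_zero]

/-- A white point that is neither equal nor opposite to the first coordinate point can be moved
to a normal form by the stabilizer of the first coordinate vector. -/
theorem IsWhite.exists_map_eq_of_not_opposite (hN : IsOctonionNorm N) {a : F} {B C : O}
    (h : IsWhite N ((a, 0, 0), (0, B, C))) (h0 : ¬ (B = 0 ∧ C = 0)) :
    ∃ g ∈ mixedIsometries N, g ((1, 0, 0), (0, 0, 0)) = ((1, 0, 0), (0, 0, 0)) ∧
      ∃ C' : O, C' ≠ 0 ∧ N C' = 0 ∧ g ((a, 0, 0), (0, B, C)) = ((0, 0, 0), (0, 0, C')) := by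
  wlog hC : C ≠ 0 generalizing B C
  · obtain ⟨s, hs, hs'⟩ := exists_mixedIsometries_swap₂₃ hN
    have hs1 : s ((1, 0, 0), (0, 0, 0)) = ((1, 0, 0), (0, 0, 0)) := by simp [hs', conj_zero]
    have hw := h.map hs
    rw [hs', conj_zero] at hw
    have hB : conj N B ≠ 0 := fun hB => h0 ⟨by rw [← hN.conj_conj B, hB, conj_zero], not_not.1 hC⟩
    obtain ⟨g, hg, hg1, C', hC', hNC', hgX⟩ := this hw (fun hh => hB hh.2) hB
    refine ⟨g * s, mul_mem hg hs, ?_, C', hC', hNC', ?_⟩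
    · rw [LinearEquiv.mul_apply, hs1, hg1]
    · rw [LinearEquiv.mul_apply, hs', conj_zero, hgX]
  obtain ⟨⟨-, -, hNC⟩, hBC, -, -⟩ := h.equations hN
  rw [smul_zero, hN.conj_mul] at hBC
  obtain ⟨z, hz⟩ := hN.exists_polar_ne_zero hC
  rw [QuadraticMap.polar_comm] at hz
  -- Whiteness gives C̄B̄ = 0, hence C(z̄B̄) = ⟨C, z⟩B̄. A transvection by a multiple of z̄B̄
  -- therefore removes B; the second one, by a multiple of y, then removes a.
  have hB := hN.mul_conj_mul_add C z (conj N B)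
  rw [← hBC, mul_zero, add_zero] at hB
  obtain ⟨t, ht, ht'⟩ := exists_mixedIsometries_transvection₂₃ hN
    (-(polar N C z)⁻¹ • (conj N z * conj N B))
  obtain ⟨y, hy⟩ := hN.exists_polar_ne_zero (x := conj N C)
    (fun hh => hC (by rw [← hN.conj_conj C, hh, conj_zero]))
  obtain ⟨u, hu, hu'⟩ := exists_mixedIsometries_transvection₂₁ hN (-(a / polar N y (conj N C)) • y)
  refine ⟨u * t, mul_mem hu ht, ?_, C, hC, ?_, ?_⟩
  · simp [LinearEquiv.mul_apply, ht', hu', conj_zero]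
  · simpa using hNC.symm
  · rw [LinearEquiv.mul_apply, ht', hu']
    refine Prod.ext (Prod.ext ?_ (Prod.ext ?_ ?_)) (Prod.ext ?_ (Prod.ext ?_ ?_))
    · simp [QuadraticMap.polar_smul_left, QuadraticMap.polar_neg_left, hy]
    · simp
    · simp
    · simp
    · simp [mul_smul_comm, hB, conj_neg, smul_smul, hz, hN.conj_conj, conj_zero]
    · simp

/-- In normal form, some isometry fixes the given point and moves the first coordinate point to an
opposite one. -/
theorem exists_map_eq_self_and_map_opposite (hN : IsOctonionNorm N) (C : O) :
    ∃ g ∈ mixedIsometries N, g ((0, 0, 0), (0, 0, C)) = ((0, 0, 0), (0, 0, C)) ∧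
      (g ((1, 0, 0), (0, 0, 0))).1.2 ≠ 0 := by
  obtain ⟨x, hx, hx'⟩ := hN.exists_polar_eq_zero_and_ne_zero C
  refine ⟨_, transvection_mem hN x, ?_, ?_⟩
  · simp [transvection_apply, hx, conj_zero]
  · simp [transvection_apply, hx']

end Orbits

/-! ### All of SE₆ preserves whiteness -/

section Invariance

variable {F O : Type*} [Field F] [NonAssocRing O] [Module F O]
variable {N : QuadraticForm F O}

open QuadraticMap (polar)

variable (N) in
/-- The complete polarization of the determinant. -/
def detPolar (X Y Z : Albert F O) : F :=
  det N (X + Y + Z) - det N (X + Y) - det N (X + Z) - det N (Y + Z)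
    + det N X + det N Y + det N Z

/-- A third difference involves only values of Δ, so no condition on the size or characteristic of
the field enters. -/
theorem detPolar_map {g : Albert F O ≃ₗ[F] Albert F O} (hg : g ∈ SE6 N) (X Y Z : Albert F O) :
    detPolar N (g X) (g Y) (g Z) = detPolar N X Y Z := by
  have h : ∀ X, det N (g X) = det N X := hg
  simp only [detPolar, ← map_add, h]

theorem detPolar_eq (a b c d e f p q r : F) (A D E G U V W : O) :
    detPolar N ((a, b, c), (A, 0, 0)) ((d, e, f), (D, E, G)) ((p, q, r), (U, V, W)) =
      a * (e * r + f * q) + b * (d * r + f * p) + c * (d * q + e * p)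
        - a * polar N D U - d * polar N A U - p * polar N A D - b * polar N E V - c * polar N G W
        + trace N (A * E * W) + trace N (A * V * G) := by
  simp only [detPolar, det, Prod.mk_add_mk, map_add_polar, add_mul, mul_add, trace_add,
    QuadraticMap.polar_add_left, QuadraticMap.map_zero, zero_add, mul_zero, trace_zero]
  ring

variable [SMulCommClass F O O] [IsScalarTower F O O]

/-- If an isometry of the determinant maps the first coordinate vector to a vector in normal form,
then the image is a multiple of the first coordinate vector. -/
theorem eq_zero_of_map_eq_normal_form (hN : IsOctonionNorm N)
    {g : Albert F O ≃ₗ[F] Albert F O} (hg : g ∈ SE6 N) {a b c : F} {A : O} (ha : a ≠ 0)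
    (h : g ((1, 0, 0), (0, 0, 0)) = ((a, b, c), (A, 0, 0))) : b = 0 ∧ c = 0 ∧ A = 0 := by
  have hfin := hN.finite
  let i : F × O × O →ₗ[F] Albert F O :=
    { toFun := fun v => ((v.1, 0, 0), (0, v.2))
      map_add' := fun v w => by simp
      map_smul' := fun k v => by simp }
  let π : Albert F O →ₗ[F] F × O × O :=
    { toFun := fun X => (X.1.1, X.2.2.1, X.2.2.2)
      map_add' := fun v w => rfl
      map_smul' := fun k v => rfl }
  -- The vectors `i v` lie in the radical of the form obtained from the polarization by fixing e₁; g
  -- carries them into the radical belonging to its image.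
  have hrad (v : F × O × O) (Z : Albert F O) :
      detPolar N ((a, b, c), (A, 0, 0)) (g (i v)) Z = 0 := by
    rw [← h, ← g.apply_symm_apply Z, detPolar_map hg]
    obtain ⟨⟨p, q, r⟩, U, V, W⟩ := g.symm Z
    obtain ⟨d, E, G⟩ := v
    change detPolar N ((1, 0, 0), (0, 0, 0)) ((d, 0, 0), (0, E, G)) _ = 0
    rw [detPolar_eq]
    simp [trace]
  let φ : F × O × O →ₗ[F] F × O × O := π ∘ₗ g.toLinearMap ∘ₗ i
  -- Since a ≠ 0, a radical vector of the image is determined by its (d, E, G) coordinates: pairing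
  -- a difference with the other coordinates kills e, f and D.
  have hinj : Function.Injective φ := by
    rw [← LinearMap.ker_eq_bot, LinearMap.ker_eq_bot']
    intro v hv
    obtain ⟨⟨⟨d, e, f⟩, D, E, G⟩, hY⟩ : ∃ Y, g (i v) = Y := ⟨_, rfl⟩
    have hr := hrad v
    have hv' : π (g (i v)) = 0 := hv
    rw [hY] at hv' hr
    obtain ⟨rfl, rfl, rfl⟩ : d = 0 ∧ E = 0 ∧ G = 0 := by simpa [π] using hv'
    have he : e = 0 := by
      have := hr ((0, 0, 1), (0, 0, 0))
      rw [detPolar_eq] at this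
      simpa [ha, trace] using this
    have hf : f = 0 := by
      have := hr ((0, 1, 0), (0, 0, 0))
      rw [detPolar_eq] at this
      simpa [ha, trace] using this
    have hD : D = 0 := hN.eq_zero_of_polar fun U => by
      have := hr ((0, 0, 0), (U, 0, 0))
      rw [detPolar_eq] at this
      simpa [ha, trace] using this
    subst he hf hD
    have hi : i v = 0 := g.map_eq_zero_iff.1 hY
    have h1 : v.1 = 0 := congrArg (·.1.1) hi
    have h2 : v.2 = 0 := congrArg (·.2.2) hi
    exact Prod.ext h1 h2
  have hsurj : Function.Surjective φ := LinearMap.injective_iff_surjective.1 hinj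
  -- By surjectivity E and G are arbitrary, so the part of the form on the last two octonion
  -- coordinates vanishes.
  have key (E G V W : O) :
      - b * polar N E V - c * polar N G W + trace N (A * E * W) + trace N (A * V * G) = 0 := by
    obtain ⟨v, hv⟩ := hsurj (0, E, G)
    obtain ⟨⟨⟨d, e, f⟩, D, E', G'⟩, hY⟩ : ∃ Y, g (i v) = Y := ⟨_, rfl⟩
    have hv' : π (g (i v)) = (0, E, G) := hv
    have hr := hrad v ((0, 0, 0), (0, V, W))
    rw [hY] at hr hv'
    obtain ⟨rfl, rfl, rfl⟩ : d = 0 ∧ E' = E ∧ G' = G := by simpa [π] using hv'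
    rw [detPolar_eq] at hr
    simpa using hr
  have := hN.nontrivial
  obtain ⟨y, hy⟩ := hN.exists_polar_ne_zero (one_ne_zero (α := O))
  rw [QuadraticMap.polar_comm] at hy
  refine ⟨?_, ?_, hN.eq_zero_of_polar fun z => ?_⟩
  · simpa [trace, hy] using key 1 0 y 0
  · simpa [trace, hy] using key 0 1 0 y
  · have := key 1 0 0 (conj N z)
    rw [mul_one, hN.trace_mul, hN.conj_conj] at this
    simpa [trace] using this

/-- Members of `mixedIsometries` before and after g reduce to e₁ being sent to a normal form, which
is then a multiple of e₁; whiteness is carried back by the inverse isometry. -/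
theorem IsWhite.map_SE6 (hN : IsOctonionNorm N) {X : Albert F O} (hX : IsWhite N X)
    {g : Albert F O ≃ₗ[F] Albert F O} (hg : g ∈ SE6 N) : IsWhite N (g X) := by
  obtain ⟨k, hk, a, ha, hkX⟩ := hX.exists_map_eq hN
  obtain ⟨l, hl, a', b, c, A, ha', hl'⟩ :=
    exists_normal_form hN (X := g X) (fun h => hX.1 (g.map_eq_zero_iff.1 h))
  have hm : l * g * k⁻¹ ∈ SE6 N :=
    mul_mem (mul_mem (mixedIsometries_le hl) hg) (inv_mem (mixedIsometries_le hk))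
  have hX' : k⁻¹ ((a, 0, 0), (0, 0, 0)) = X := by
    rw [← hkX, ← LinearEquiv.mul_apply, inv_mul_cancel]; rfl
  have h1 : (l * g * k⁻¹) ((1, 0, 0), (0, 0, 0)) = ((a⁻¹ * a', a⁻¹ * b, a⁻¹ * c), (a⁻¹ • A, 0, 0)) := by
    have : (((1, 0, 0), (0, 0, 0)) : Albert F O) = a⁻¹ • ((a, 0, 0), (0, 0, 0)) := by simp [ha]
    rw [this, map_smul, LinearEquiv.mul_apply, LinearEquiv.mul_apply, hX', hl']
    simp
  obtain ⟨hb, hc, hA⟩ := eq_zero_of_map_eq_normal_form hN hm (by simp [ha, ha']) h1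
  obtain ⟨rfl, rfl, rfl⟩ : b = 0 ∧ c = 0 ∧ A = 0 := by
    simpa [ha] using And.intro hb (And.intro hc hA)
  have := (isWhite_diagonal (N := N) ha').map (inv_mem hl)
  rwa [← hl', ← LinearEquiv.mul_apply, inv_mul_cancel] at this

end Invariance

/-! ### Primitivity and 2-transitivity on white points -/

section Points

variable {F O : Type*} [Field F] [NonAssocRing O] [Module F O]
variable {N : QuadraticForm F O} [SMulCommClass F O O] [IsScalarTower F O O]

theorem exists_eq_of_not_opposite {X : Albert F O} (h0 : X.1.2 = 0 ∧ X.2.1 = 0) :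
    ∃ (a : F) (B C : O), X = ((a, 0, 0), (0, B, C)) :=
  ⟨X.1.1, X.2.2.1, X.2.2.2, Prod.ext (Prod.ext rfl h0.1) (Prod.ext h0.2 rfl)⟩

theorem span_eq_span_diagonal {a : F} (h : (((a, 0, 0), (0, 0, 0)) : Albert F O) ≠ 0) :
    Submodule.span F {(((a, 0, 0), (0, 0, 0)) : Albert F O)} =
      Submodule.span F {((1, 0, 0), (0, 0, 0))} := by
  have ha : a ≠ 0 := fun ha => h (by rw [ha]; rfl)
  have : (((a, 0, 0), (0, 0, 0)) : Albert F O) = a • ((1, 0, 0), (0, 0, 0)) := by simp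
  rw [this, Submodule.span_singleton_smul_eq (IsUnit.mk0 a ha)]

/-- A family of white vectors that behaves like a block of imprimitivity containing two points
contains all white vectors. -/
theorem forall_isWhite_of_block (hN : IsOctonionNorm N) {S : Albert F O → Prop}
    (hsmul : ∀ (c : F) (X : Albert F O), c ≠ 0 → IsWhite N (c • X) → S X → S (c • X))
    (hblock : ∀ g ∈ mixedIsometries N, ∀ X Y, IsWhite N X → IsWhite N Y →
      S X → S (g X) → S Y → S (g Y))
    (h1 : S ((1, 0, 0), (0, 0, 0))) {Y : Albert F O} (hY : IsWhite N Y) (hSY : S Y)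
    (hne : Submodule.span F {Y} ≠ Submodule.span F {((1, 0, 0), (0, 0, 0))})
    {Z : Albert F O} (hZ : IsWhite N Z) : S Z := by
  have hw1 : IsWhite N ((1, 0, 0), (0, 0, 0)) := isWhite_diagonal one_ne_zero
  have hinv (g : Albert F O ≃ₗ[F] Albert F O) (X : Albert F O) : g⁻¹ (g X) = X := by
    rw [← LinearEquiv.mul_apply, inv_mul_cancel]; rfl
  -- If Y is not opposite, it is first moved to (0,0,0|0,0,C'). The isometry `t` fixes this vector,
  -- so it preserves the block, but it makes e₁ opposite.
  have hopp : ∃ Y, IsWhite N Y ∧ S Y ∧ ¬ (Y.1.2 = 0 ∧ Y.2.1 = 0) := by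
    by_contra! h
    obtain ⟨a, B, C, rfl⟩ := exists_eq_of_not_opposite (h Y hY hSY)
    have h0 : ¬ (B = 0 ∧ C = 0) := by
      rintro ⟨rfl, rfl⟩
      exact hne (span_eq_span_diagonal hY.1)
    obtain ⟨g, hg, hg1, C', -, -, hgY⟩ := hY.exists_map_eq_of_not_opposite hN h0
    obtain ⟨t, ht, htY, ht1⟩ := exists_map_eq_self_and_map_opposite hN C'
    have hS := hblock g hg _ _ hw1 hY h1 (by rwa [hg1]) hSY
    have hwC := hY.map hg
    rw [hgY] at hS hwC
    exact ht1 (h _ (hw1.map ht) (hblock t ht _ _ hwC hw1 hS (by rwa [htY]) h1)).1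
  have h2 : S ((0, 1, 0), (0, 0, 0)) := by
    obtain ⟨Y, hY, hSY, h0⟩ := hopp
    obtain ⟨g, hg, hg1, b, hb, hgY⟩ := hY.exists_map_eq_of_opposite hN h0
    have hS := hblock g hg _ _ hw1 hY h1 (by rwa [hg1]) hSY
    rw [hgY] at hS
    have he : b⁻¹ • (((0, b, 0), (0, 0, 0)) : Albert F O) = ((0, 1, 0), (0, 0, 0)) := by simp [hb]
    rw [← he]
    exact hsmul b⁻¹ _ (inv_ne_zero hb) (he ▸ hw1.map (inv_mem (rotation_mem hN))) hS
  have hall (Z : Albert F O) (hZ : IsWhite N Z) (h0 : ¬ (Z.1.2 = 0 ∧ Z.2.1 = 0)) : S Z := by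
    obtain ⟨g, hg, hg1, b, hb, hgZ⟩ := hZ.exists_map_eq_of_opposite hN h0
    have he : b • (((0, 1, 0), (0, 0, 0)) : Albert F O) = g Z := by rw [hgZ]; simp
    have hS := hsmul b _ hb (he ▸ hZ.map hg) h2
    rw [he] at hS
    have := hblock g⁻¹ (inv_mem hg) _ _ hw1 (hZ.map hg) h1 (by rwa [← hg1, hinv]) hS
    rwa [hinv] at this
  have hr := rotation_mem (N := N) hN
  -- The inverse rotation sends e₁ to e₂, and both lie in S, so it preserves S.
  have hrot (Z : Albert F O) (hZ : IsWhite N Z) (h : S (rotation F O Z)) : S Z := by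
    have := hblock _ (inv_mem hr) _ _ hw1 (hZ.map hr) h1 h2 h
    rwa [hinv] at this
  -- A white vector outside S would be opposite to none of the three coordinate points, which makes
  -- all its entries zero.
  by_contra hS
  obtain ⟨a, B, C, rfl⟩ := exists_eq_of_not_opposite (not_not.1 (mt (hall Z hZ) hS))
  have h3 := not_not.1 (mt (hall _ (hZ.map hr)) (mt (hrot _ hZ) hS))
  have h4 := not_not.1 (mt (hall _ ((hZ.map hr).map hr))
    (mt (fun h => hrot _ hZ (hrot _ (hZ.map hr) h)) hS))
  simp only [rotation_apply, Prod.mk_eq_zero, true_and] at h3 h4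
  obtain ⟨ha, rfl⟩ := h3
  obtain ⟨-, rfl⟩ := h4
  subst ha
  exact hZ.1 rfl

/-- If the octonions are not split, then any two white points can be moved to the first two
coordinate points. -/
theorem exists_map_pair (hN : IsOctonionNorm N) (hs : ¬ IsSplit N) {X Y : Albert F O}
    (hX : IsWhite N X) (hY : IsWhite N Y)
    (hne : Submodule.span F {X} ≠ Submodule.span F {Y}) :
    ∃ g ∈ mixedIsometries N, ∃ a b : F, a ≠ 0 ∧ b ≠ 0 ∧
      g X = ((a, 0, 0), (0, 0, 0)) ∧ g Y = ((0, b, 0), (0, 0, 0)) := by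
  have hs' (x : O) (hx : N x = 0) : x = 0 := by
    by_contra h
    exact hs ⟨x, h, hx⟩
  obtain ⟨g, hg, a, ha, hgX⟩ := hX.exists_map_eq hN
  have h0 : ¬ ((g Y).1.2 = 0 ∧ (g Y).2.1 = 0) := by
    intro h0
    obtain ⟨b, B, C, hgY⟩ := exists_eq_of_not_opposite h0
    have hw := hY.map hg
    rw [hgY] at hw
    obtain ⟨⟨-, hB, hC⟩, -⟩ := hw.equations hN
    -- Whiteness gives N(B) = N(C) = 0, so without isotropic vectors a point that is not opposite
    -- coincides with ⟨e₁⟩.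
    obtain rfl := hs' B (by simpa using hB.symm)
    obtain rfl := hs' C (by simpa using hC.symm)
    have h1 := span_eq_span_diagonal hw.1
    rw [← span_eq_span_diagonal (hgX ▸ (hX.map hg).1), ← hgX, ← hgY] at h1
    refine hne (Submodule.map_injective_of_injective (f := g.toLinearMap) g.injective ?_)
    rw [Submodule.map_span, Submodule.map_span, Set.image_singleton, Set.image_singleton]
    exact h1.symm
  obtain ⟨k, hk, hk1, b, hb, hkY⟩ := (hY.map hg).exists_map_eq_of_opposite hN h0
  refine ⟨k * g, mul_mem hk hg, a, b, ha, hb, ?_, hkY⟩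
  rw [LinearEquiv.mul_apply, hgX]
  have : (((a, 0, 0), (0, 0, 0)) : Albert F O) = a • ((1, 0, 0), (0, 0, 0)) := by simp
  rw [this, map_smul, hk1]

theorem smul_span_singleton (g : SE6 N) (X : Albert F O) :
    g • Submodule.span F {X} =
      Submodule.span F {(g : Albert F O ≃ₗ[F] Albert F O) X} := by
  rw [smul_eq_map, Submodule.map_span, Set.image_singleton]
  rfl

/-- The set of white points with the action of `SE6 N`. -/
def whiteSubMulAction (hN : IsOctonionNorm N) :
    SubMulAction (SE6 N) (Submodule F (Albert F O)) where
  carrier := whitePoints N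
  smul_mem' := by
    rintro g _ ⟨X, hX, rfl⟩
    exact ⟨_, hX.map_SE6 hN g.2, smul_span_singleton g X⟩

/-- The white point spanned by a white vector. -/
def whitePoint (hN : IsOctonionNorm N) {X : Albert F O} (hX : IsWhite N X) :
    whiteSubMulAction hN :=
  ⟨Submodule.span F {X}, X, hX, rfl⟩

theorem smul_whitePoint_eq (hN : IsOctonionNorm N) {X Y : Albert F O} (hX : IsWhite N X)
    (hY : IsWhite N Y) {g : Albert F O ≃ₗ[F] Albert F O} (hg : g ∈ mixedIsometries N) {c : F}
    (hc : c ≠ 0) (h : g X = c • Y) :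
    (⟨g, mixedIsometries_le hg⟩ : SE6 N) • whitePoint hN hX = whitePoint hN hY := by
  refine Subtype.ext ?_
  change _ • Submodule.span F {X} = Submodule.span F {Y}
  rw [smul_span_singleton]
  change Submodule.span F {g X} = _
  rw [h, Submodule.span_singleton_smul_eq (IsUnit.mk0 c hc)]

theorem isPretransitive_white (hN : IsOctonionNorm N) :
    MulAction.IsPretransitive (SE6 N) (whiteSubMulAction hN) := by
  have hw1 : IsWhite N ((1, 0, 0), (0, 0, 0)) := isWhite_diagonal one_ne_zero
  rw [MulAction.isPretransitive_iff_base (whitePoint hN hw1)]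
  rintro ⟨_, X, hX, rfl⟩
  obtain ⟨g, hg, a, ha, hgX⟩ := hX.exists_map_eq hN
  refine ⟨(⟨g, mixedIsometries_le hg⟩ : SE6 N)⁻¹, ?_⟩
  rw [inv_smul_eq_iff]
  exact (smul_whitePoint_eq hN hX hw1 hg ha (by simp [hgX])).symm

theorem isPreprimitive_white (hN : IsOctonionNorm N) :
    MulAction.IsPreprimitive (SE6 N) (whiteSubMulAction hN) := by
  have hw1 : IsWhite N ((1, 0, 0), (0, 0, 0)) := isWhite_diagonal one_ne_zero
  have := isPretransitive_white hN
  refine MulAction.IsPreprimitive.of_isTrivialBlock_base (whitePoint hN hw1) fun {B} h1 hB => ?_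
  by_cases hsub : B ⊆ {whitePoint hN hw1}
  · exact .inl (Set.subsingleton_singleton.anti hsub)
  right
  obtain ⟨⟨_, Y, hY, rfl⟩, hYB, hne⟩ := Set.not_subset.1 hsub
  -- The block is transcribed to vectors; it is closed under non-zero scaling because only the span
  -- matters.
  let S (X : Albert F O) : Prop := ∃ hX : IsWhite N X, whitePoint hN hX ∈ B
  refine Set.eq_univ_of_forall ?_
  rintro ⟨_, Z, hZ, rfl⟩
  refine (forall_isWhite_of_block hN (S := S) ?_ ?_ ⟨hw1, h1⟩ hY ⟨hY, hYB⟩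
    (fun h => hne (Subtype.ext h)) hZ).2
  · rintro c X hc hcX ⟨hX, hXB⟩
    refine ⟨hcX, ?_⟩
    rwa [show whitePoint hN hcX = whitePoint hN hX from
      Subtype.ext (Submodule.span_singleton_smul_eq (IsUnit.mk0 c hc) X)]
  · rintro g hg X Y hX hY ⟨_, hXB⟩ ⟨hgX, hgXB⟩ ⟨_, hYB⟩
    refine ⟨hY.map hg, ?_⟩
    have e := smul_whitePoint_eq hN hX hgX hg one_ne_zero (one_smul F _).symm
    have e' := smul_whitePoint_eq hN hY (hY.map hg) hg one_ne_zero (one_smul F _).symm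
    rw [← e']
    rw [← e] at hgXB
    rw [← hB.smul_eq_of_mem hXB hgXB]
    exact Set.smul_mem_smul_set hYB

theorem isMultiplyPretransitive_white (hN : IsOctonionNorm N) (hs : ¬ IsSplit N) :
    MulAction.IsMultiplyPretransitive (SE6 N) (whiteSubMulAction hN) 2 := by
  have hw1 : IsWhite N ((1, 0, 0), (0, 0, 0)) := isWhite_diagonal one_ne_zero
  have hw2 : IsWhite N ((0, 1, 0), (0, 0, 0)) := hw1.map (inv_mem (rotation_mem hN))
  have key (P Q : whiteSubMulAction hN) (h : P ≠ Q) :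
      ∃ g : SE6 N, g • P = whitePoint hN hw1 ∧ g • Q = whitePoint hN hw2 := by
    obtain ⟨_, X, hX, rfl⟩ := P
    obtain ⟨_, Y, hY, rfl⟩ := Q
    obtain ⟨g, hg, a, b, ha, hb, hgX, hgY⟩ :=
      exists_map_pair hN hs hX hY (fun h' => h (Subtype.ext h'))
    exact ⟨⟨g, mixedIsometries_le hg⟩, smul_whitePoint_eq hN hX hw1 hg ha (by simp [hgX]),
      smul_whitePoint_eq hN hY hw2 hg hb (by simp [hgY])⟩
  rw [MulAction.is_two_pretransitive_iff]
  intro P Q P' Q' h h'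
  obtain ⟨g, hP, hQ⟩ := key P Q h
  obtain ⟨g', hP', hQ'⟩ := key P' Q' h'
  exact ⟨g'⁻¹ * g, by rw [mul_smul, hP, ← hP', inv_smul_smul],
    by rw [mul_smul, hQ, ← hQ', inv_smul_smul]⟩

theorem whitePoints_nontrivial (hN : IsOctonionNorm N) : (whitePoints N).Nontrivial := by
  have hw1 : IsWhite N ((1, 0, 0), (0, 0, 0)) := isWhite_diagonal one_ne_zero
  have hw2 : IsWhite N ((0, 1, 0), (0, 0, 0)) := hw1.map (inv_mem (rotation_mem hN))
  refine ⟨_, ⟨_, hw1, rfl⟩, _, ⟨_, hw2, rfl⟩, fun h => ?_⟩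
  have := Submodule.mem_span_singleton_self (R := F) (((1, 0, 0), (0, 0, 0)) : Albert F O)
  rw [h, Submodule.mem_span_singleton] at this
  obtain ⟨c, hc⟩ := this
  simpa using congrArg (·.1.1) hc

end Points

end AlbertE6

theorem mainTheorem6 {F O : Type*} [Field F] [NonAssocRing O] [Module F O]
    [SMulCommClass F O O] [IsScalarTower F O O]
    (N : QuadraticForm F O) (hN : AlbertE6.IsOctonionNorm N) :
    (AlbertE6.whitePoints N).Nontrivial ∧
    ∃ W : SubMulAction (AlbertE6.SE6 N) (Submodule F (AlbertE6.Albert F O)),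
      (W : Set (Submodule F (AlbertE6.Albert F O))) = AlbertE6.whitePoints N ∧
      MulAction.IsPreprimitive (AlbertE6.SE6 N) W ∧
      (¬ AlbertE6.IsSplit N → MulAction.IsMultiplyPretransitive (AlbertE6.SE6 N) W 2) :=
  ⟨AlbertE6.whitePoints_nontrivial hN, AlbertE6.whiteSubMulAction hN, rfl,
    AlbertE6.isPreprimitive_white hN, AlbertE6.isMultiplyPretransitive_white hN⟩
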